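/- Let $\mathrm{M}$ be a matroid on a finite ground set, let $\mathcal{L}=\mathcal{L}(\mathrm{M})$ be its lattice of flats ordered by inclusion, with least element $\hat 0$, and let $\mathrm{G}\subseteq\mathcal{L}\setminus\{\hat 0\}$ be any building set of $\mathcal{L}$; that is, for every $F\in\mathcal{L}$ the join map $$\prod_{G\in\max\mathrm{G}_{\leqslant F}}[\hat 0,G]\longrightarrow[\hat 0,F],\qquad (H_G)_G\longmapsto\bigvee_G H_G,$$ is an isomorphism of posets, where $\max\mathrm{G}_{\leqslant F}$ is the set of maximal elements of $\{G\in\mathrm{G}\mid G\leqslant F\}$. Let $\mathbf{N}(\mathcal{L},\mathrm{G})$ be the nested set complex: the simplicial complex whose faces are the sets $S$ of non-maximal elements of $\mathrm{G}$ such that no antichain $A\subseteq S$ with $|A|\geqslant 2$ satisfies $\bigvee A\in\mathrm{G}$. Then $\mathbf{N}(\mathcal{L}(\mathrm{M}),\mathrm{G})$ is vertex decomposable and, in particular, shellable. Here $\varnothing$ counts as a face, of dimension $-1$. A complex $\Delta$ is pure if all its facets (maximal faces) have the same dimension. For a vertex $v$, the deletion is $\Delta\setminus\{v\}=\{H\in\Delta\mid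 v\notin H\}$ and the link is $\mathrm{lk}_\Delta(v)=\{H\mid v\notin H,\ H\cup\{v\}\in\Delta\}$. A complex $\Delta$ is vertex decomposable if it is a simplex (all the subsets of one finite, possibly empty, set) or, inductively, if it is pure and has a vertex $v$ such that every facet of $\Delta\setminus\{v\}$ is a facet of $\Delta$ and both $\Delta\setminus\{v\}$ and $\mathrm{lk}_\Delta(v)$ are vertex decomposable. A complex $\Delta$ is shellable if it is pure, of some dimension $d$, and its facets can be ordered as $F_1,\dots,F_k$ so that for $2\leqslant i\leqslant k$ the complex $\langle F_1,\dots,F_{i-1}\rangle\cap\langle F_i\rangle$ is pure of dimension $d-1$, where $\langle\cdot\rangle$ denotes the complex generated by the given faces. -/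

import Mathlib

namespace NestedSets

/-! ### Simplicial complexes

A simplicial complex is a collection of finite sets (its faces) that is closed under inclusion,
that is, a `LowerSet (Finset V)`. The empty set is a face (of dimension `-1`) of every complex
that has a face at all. The vertices are the `v` for which `{v}` is a face. -/

/-- Simplicial complexes with vertices in `V`. -/
abbrev Complex (V : Type*) := LowerSet (Finset V)

section Complexes

variable {V : Type*}

/-- A facet is an inclusion-maximal face. -/
def IsFacet (Δ : Complex V) (F : Finset V) : Prop :=
  Maximal (fun H => H ∈ Δ) F

/-- `Δ` is pure: all its facets have the same dimension, that is, the same cardinality. -/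
def IsPure (Δ : Complex V) : Prop :=
  ∀ F F' : Finset V, IsFacet Δ F → IsFacet Δ F' → F.card = F'.card

/-- `Δ` has a facet and all its facets have dimension `d`, where `dim F = |F| - 1`. -/
def IsPureOfDim (Δ : Complex V) (d : ℤ) : Prop :=
  (∃ F, IsFacet Δ F) ∧ ∀ F, IsFacet Δ F → (F.card : ℤ) - 1 = d

/-- `Δ` is a simplex: its faces are all the subsets of one finite set (possibly empty). -/
def IsSimplex (Δ : Complex V) : Prop :=
  ∃ F : Finset V, ∀ H : Finset V, H ∈ Δ ↔ H ⊆ F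

/-- The deletion `Δ \ F`: the faces of `Δ` that do not contain `F`. -/
def deletion (Δ : Complex V) (F : Finset V) : Complex V where
  carrier := {H | H ∈ Δ ∧ ¬ F ⊆ H}
  lower' := fun _ _ hle h => ⟨Δ.lower hle h.1, fun hF => h.2 (hF.trans hle)⟩

open Classical in
/-- The link of `F` in `Δ`: the sets `H` disjoint from `F` with `F ∪ H` a face of `Δ`. -/
def link (Δ : Complex V) (F : Finset V) : Complex V where
  carrier := {H | Disjoint F H ∧ F ∪ H ∈ Δ}
  lower' := fun _ _ hle h =>
    ⟨h.1.mono_right hle, Δ.lower (Finset.union_subset_union_right hle) h.2⟩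

/-- Vertex decomposable complexes: simplices and, inductively, the pure complexes with a shedding
vertex whose deletion and link are both vertex decomposable. -/
inductive VertexDecomposable : Complex V → Prop
  | simplex (Δ : Complex V) (h : IsSimplex Δ) : VertexDecomposable Δ
  | shed (Δ : Complex V) (hpure : IsPure Δ) (v : V) (hv : {v} ∈ Δ)
      (shedding : ∀ F, IsFacet (deletion Δ {v}) F → IsFacet Δ F)
      (hdel : VertexDecomposable (deletion Δ {v}))
      (hlink : VertexDecomposable (link Δ {v})) : VertexDecomposable Δ

/-- The smallest complex that contains all the members of `A`. -/
def generated (A : Set (Finset V)) : Complex V := lowerClosure A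

/-- `Δ` is pure, of some dimension `d`, and its facets can be ordered as `F 0, …, F (k - 1)` so
that for every `i` other than the first index the complex
`⟨F 0, …, F (i - 1)⟩ ∩ ⟨F i⟩` is pure of dimension `d - 1`. -/
def Shellable (Δ : Complex V) : Prop :=
  ∃ d : ℤ, IsPureOfDim Δ d ∧
    ∃ (k : ℕ) (F : Fin k → Finset V),
      Function.Injective F ∧ (∀ H, IsFacet Δ H ↔ H ∈ Set.range F) ∧
      ∀ i : Fin k, 0 < (i : ℕ) →
        IsPureOfDim (generated {H | ∃ j < i, H = F j} ⊓ generated {F i}) (d - 1)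

end Complexes

/-! ### Building sets and nested sets -/

section BuiltLattices

variable {L : Type*} [CompleteLattice L]

/-- The `G`-factors of `F`: the maximal elements of `{x ∈ G | x ≤ F}`. -/
def factors (G : Set L) (F : L) : Set L :=
  {x | Maximal (fun y => y ∈ G ∧ y ≤ F) x}

/-- The join map from the product of the intervals `[⊥, x]`, over the factors `x` of `F`,
to the interval `[⊥, F]`. -/
def joinMap (G : Set L) (F : L) (H : (x : factors G F) → Set.Iic (x : L)) : Set.Iic F :=
  ⟨⨆ x, (H x : L), iSup_le fun x => (H x).2.trans x.2.1.2⟩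

/-- `G` does not contain `⊥`, and all its join maps are isomorphisms of posets. -/
structure IsBuildingSet (G : Set L) : Prop where
  bot_notMem : ⊥ ∉ G
  joinMap_iso : ∀ F : L, ∃ e : ((x : factors G F) → Set.Iic (x : L)) ≃o Set.Iic F,
    ∀ H, e H = joinMap G F H

/-- `S` is a subset of `G` in which no antichain with at least two elements has its join
in `G`. -/
def IsNested (G : Set L) (S : Finset L) : Prop :=
  (S : Set L) ⊆ G ∧
    ∀ A ⊆ S, 2 ≤ A.card → IsAntichain (· ≤ ·) (A : Set L) → sSup (A : Set L) ∉ G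

/-- The complex of all nested sets, with vertex set `G`. -/
def fullNestedSetComplex (G : Set L) : Complex L where
  carrier := {S | IsNested G S}
  lower' := fun _ _ hle h =>
    ⟨(Finset.coe_subset.2 hle).trans h.1, fun A hA => h.2 A (hA.trans hle)⟩

/-- The nested set complex: the nested sets without maximal elements of `G`. -/
def nestedSetComplex (G : Set L) : Complex L where
  carrier := {S | S ∈ fullNestedSetComplex G ∧ ∀ x ∈ S, ¬ Maximal (fun y => y ∈ G) x}
  lower' := fun _ _ hle h =>
    ⟨(fullNestedSetComplex G).lower hle h.1, fun x hx => h.2 x (hle hx)⟩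

end BuiltLattices

/-! ### The lattice of flats of a matroid -/

/-- The flats of `M`, ordered by inclusion. -/
abbrev Flats {α : Type*} (M : Matroid α) := {F : Set α // M.IsFlat F}

/-- The infimum of a set of flats is its intersection (taken inside the ground set). -/
instance {α : Type*} (M : Matroid α) : InfSet (Flats M) where
  sInf S := ⟨⋂ F : (insert ⟨M.E, M.ground_isFlat⟩ S : Set (Flats M)), (F : Flats M).1,
    haveI : Nonempty (insert ⟨M.E, M.ground_isFlat⟩ S : Set (Flats M)) :=
      ⟨⟨_, Set.mem_insert _ _⟩⟩
    Matroid.IsFlat.iInter fun F => (F : Flats M).2⟩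

/-- The lattice of flats of `M`: the order is inclusion. -/
instance {α : Type*} (M : Matroid α) : CompleteLattice (Flats M) :=
  completeLatticeOfInf (Flats M) fun S => by
    refine ⟨fun F hF => ?_, fun F hF => ?_⟩
    · exact Set.iInter_subset
        (fun F : (insert ⟨M.E, M.ground_isFlat⟩ S : Set (Flats M)) => (F : Flats M).1)
        ⟨F, Set.mem_insert_of_mem _ hF⟩
    · refine Set.subset_iInter fun H => ?_
      obtain ⟨H, rfl | hH⟩ := H
      · exact F.2.subset_ground
      · exact hF hH

end NestedSets

/-! Only three facts about the lattice of flats matter: it is finite, it is atomistic, and it has a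
strictly increasing rank that grows by at most one on joining an atom.

Generalise to `relativeComplex G K T U`: the members of `T` are compatible with every face, those in
`K` are barred as vertices, and new vertices come from `U`. With a set `A` of atoms, `U` consists of
the `s` that are joins of members of `T` strictly below `s` and of atoms of `A` below `s`. For `A`
all atoms and `T = K` the maximal elements of `G`, this is the nested set complex.

Induct on `A`. On removing an atom `e`, the vertices lost all lie above `e`, so those in a common
face form a chain (`IsNested.comparable`). Shed them one at a time, minimal first. In the link of
such an `x` the other lost vertices lie above `x`, so `x` takes over the role of `e` and the link is
a complex for `A` (`IsGood.link_relativeComplex`). Once all are shed, `T` may need enlarging, which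
leaves the complex unchanged (`IsGood.exists_of_insert`). For `A = ∅` only the simplex on `T \ K` is
left.

The count `F.card + K.card = rk ⊤` for facets `F` travels with the induction; it gives both purity
and the shedding condition (`VertexDecomposable.of_card`). -/

namespace NestedSets

/-! ### Vertex decomposability and shellings -/

section Complexes

variable {V : Type*}

theorem mem_deletion_singleton {Δ : Complex V} {v : V} {H : Finset V} :
    H ∈ deletion Δ {v} ↔ H ∈ Δ ∧ v ∉ H := by
  change (H ∈ Δ ∧ ¬ {v} ⊆ H) ↔ _
  rw [Finset.singleton_subset_iff]

open Classical in
theorem mem_link_singleton {Δ : Complex V} {v : V} {H : Finset V} :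
    H ∈ link Δ {v} ↔ v ∉ H ∧ insert v H ∈ Δ := by
  change (Disjoint {v} H ∧ {v} ∪ H ∈ Δ) ↔ _
  rw [Finset.disjoint_singleton_left, Finset.insert_eq]

theorem exists_isFacet_ge [Finite V] {Δ : Complex V} {H : Finset V} (hH : H ∈ Δ) :
    ∃ F, IsFacet Δ F ∧ H ⊆ F := by
  obtain ⟨F, hF, hm⟩ := (Set.toFinite {H | H ∈ Δ}).exists_le_maximal hH
  exact ⟨F, hm, hF⟩

theorem IsFacet.deletion {Δ : Complex V} {v : V} {F : Finset V} (hF : IsFacet Δ F) (hv : v ∉ F) :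
    IsFacet (deletion Δ {v}) F :=
  ⟨mem_deletion_singleton.2 ⟨hF.1, hv⟩, fun _ h hle => hF.2 (mem_deletion_singleton.1 h).1 hle⟩

open Classical in
theorem isFacet_link_iff {Δ : Complex V} {v : V} {H : Finset V} :
    IsFacet (link Δ {v}) H ↔ v ∉ H ∧ IsFacet Δ (insert v H) := by
  constructor
  · intro h
    have h1 := mem_link_singleton.1 h.1
    refine ⟨h1.1, h1.2, fun F hF hle => ?_⟩
    have hvF : v ∈ F := hle (Finset.mem_insert_self v H)
    have h2 : F.erase v ∈ link Δ {v} :=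
      mem_link_singleton.2 ⟨Finset.notMem_erase v F, by rwa [Finset.insert_erase hvF]⟩
    have h3 : H ⊆ F.erase v := Finset.subset_erase.2
      ⟨(Finset.subset_insert v H).trans hle, h1.1⟩
    have := Finset.insert_subset_insert v (h.2 h2 h3)
    rwa [Finset.insert_erase hvF] at this
  · rintro ⟨hv, h⟩
    refine ⟨mem_link_singleton.2 ⟨hv, h.1⟩, fun F hF hle => ?_⟩
    have h1 := mem_link_singleton.1 hF
    have h2 := h.2 h1.2 (Finset.insert_subset_insert v hle)
    exact (Finset.insert_subset_insert_iff h1.1).1 h2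

open Classical in
/-- A vertex is a shedding vertex if the facets of its deletion have one more element than the
facets of its link. -/
theorem VertexDecomposable.of_card [Finite V] {Δ : Complex V} {v : V} {c r : ℕ} (hv : {v} ∈ Δ)
    (hdel : VertexDecomposable (deletion Δ {v}))
    (hdel' : ∀ F, IsFacet (deletion Δ {v}) F → F.card + c = r)
    (hlink : VertexDecomposable (link Δ {v}))
    (hlink' : ∀ F, IsFacet (link Δ {v}) F → F.card + (c + 1) = r) :
    VertexDecomposable Δ ∧ ∀ F, IsFacet Δ F → F.card + c = r := by
  have hcard : ∀ F, IsFacet Δ F → F.card + c = r := by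
    intro F hF
    by_cases hvF : v ∈ F
    · have h := hlink' (F.erase v) (isFacet_link_iff.2
        ⟨Finset.notMem_erase v F, by rwa [Finset.insert_erase hvF]⟩)
      have := Finset.card_erase_add_one hvF
      omega
    · exact hdel' F (hF.deletion hvF)
  refine ⟨.shed Δ (fun F F' hF hF' => ?_) v hv (fun F hF => ?_) hdel hlink, hcard⟩
  · have := hcard F hF
    have := hcard F' hF'
    omega
  -- A facet of the deletion lies in a facet of `Δ` of the same cardinality, so the two are equal.
  · obtain ⟨F', hF', hle⟩ := exists_isFacet_ge (mem_deletion_singleton.1 hF.1).1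
    have h1 := hcard F' hF'
    have h2 := hdel' F hF
    rwa [Finset.eq_of_subset_of_card_le hle (by omega)]

/-- An ordering of the facets, given by a function to `ℕ`, is a shelling if each facet meets the
union of its predecessors in faces of codimension one. -/
def IsShellingOrder (Δ : Complex V) (f : Finset V → ℕ) : Prop :=
  (∀ F F', IsFacet Δ F → IsFacet Δ F' → f F = f F' → F = F') ∧
    ∀ F F', IsFacet Δ F → IsFacet Δ F' → f F' < f F →
      ∃ F'', IsFacet Δ F'' ∧ f F'' < f F ∧
        ∃ H, H ⊆ F ∧ H ⊆ F'' ∧ H.card + 1 = F.card ∧ ∀ v ∈ F, v ∈ F' → v ∈ H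

-- Shell the deletion first, then the facets through `v` in the order of a shelling of the link.
open Classical in
theorem VertexDecomposable.exists_isShellingOrder [Finite V] {Δ : Complex V}
    (h : VertexDecomposable Δ) : IsPure Δ ∧ ∃ f, IsShellingOrder Δ f := by
  induction h with
  | simplex Δ h =>
    obtain ⟨S, hS⟩ := h
    have hfac : ∀ F, IsFacet Δ F → F = S := fun F hF =>
      subset_antisymm ((hS F).1 hF.1) (hF.2 ((hS S).2 le_rfl) ((hS F).1 hF.1))
    refine ⟨fun F F' hF hF' => by rw [hfac F hF, hfac F' hF'], fun _ => 0,
      fun F F' hF hF' _ => by rw [hfac F hF, hfac F' hF'], fun F F' _ _ h => absurd h (by simp)⟩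
  | shed Δ hpure v hv shedding hdel hlink ihd ihl =>
    refine ⟨hpure, ?_⟩
    obtain ⟨-, f, hf1, hf2⟩ := ihd
    obtain ⟨-, g, hg1, hg2⟩ := ihl
    -- Adding `N` places every facet through `v` after all the facets that avoid `v`.
    obtain ⟨N, hN⟩ : ∃ N, ∀ F, f F < N := by
      obtain ⟨N, hN⟩ := (Set.finite_range f).bddAbove
      exact ⟨N + 1, fun F => Nat.lt_succ_of_le (hN ⟨F, rfl⟩)⟩
    have hlk : ∀ F, IsFacet Δ F → v ∈ F → IsFacet (link Δ {v}) (F.erase v) := fun F hF hvF =>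
      isFacet_link_iff.2 ⟨Finset.notMem_erase v F, by rwa [Finset.insert_erase hvF]⟩
    refine ⟨fun F => if v ∈ F then N + g (F.erase v) else f F, ?_, ?_⟩
    · intro F F' hF hF' heq
      by_cases h1 : v ∈ F <;> by_cases h2 : v ∈ F' <;> simp only [h1, h2, if_true, if_false] at heq
      · rw [← Finset.insert_erase h1, ← Finset.insert_erase h2,
          hg1 _ _ (hlk F hF h1) (hlk F' hF' h2) (by omega)]
      · have := hN F'
        omega
      · have := hN F
        omega
      · exact hf1 _ _ (hF.deletion h1) (hF'.deletion h2) heq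
    · intro F F' hF hF' hlt
      by_cases h1 : v ∈ F
      · by_cases h2 : v ∈ F'
        · simp only [h1, h2, if_true] at hlt
          obtain ⟨F'', hF'', hlt'', H, hH1, hH2, hH3, hH4⟩ :=
            hg2 _ _ (hlk F hF h1) (hlk F' hF' h2) (by omega)
          obtain ⟨hvF'', hfac⟩ := isFacet_link_iff.1 hF''
          refine ⟨insert v F'', hfac, ?_, insert v H, ?_, ?_, ?_, ?_⟩
          · simp only [Finset.mem_insert_self, h1, if_true, Finset.erase_insert hvF'']
            omega
          · exact Finset.insert_subset h1 (hH1.trans (Finset.erase_subset v F))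
          · exact Finset.insert_subset_insert v hH2
          · rw [Finset.card_insert_of_notMem fun h => hvF'' (hH2 h), hH3,
              Finset.card_erase_add_one h1]
          · intro u hu hu'
            by_cases huv : u = v
            · simp [huv]
            · exact Finset.mem_insert_of_mem
                (hH4 u (Finset.mem_erase.2 ⟨huv, hu⟩) (Finset.mem_erase.2 ⟨huv, hu'⟩))
        -- The shedding condition enters here: `F.erase v` lies in a facet of the deletion, which is
        -- an earlier facet of `Δ`.
        · obtain ⟨F'', hF'', hle⟩ := exists_isFacet_ge (mem_deletion_singleton.2
            ⟨Δ.lower (Finset.erase_subset v F) hF.1, Finset.notMem_erase v F⟩)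
          refine ⟨F'', shedding _ hF'', ?_, F.erase v, Finset.erase_subset v F, hle,
            Finset.card_erase_add_one h1, fun u hu hu' => Finset.mem_erase.2
              ⟨fun h => h2 (h ▸ hu'), hu⟩⟩
          simp only [h1, (mem_deletion_singleton.1 hF''.1).2, if_true, if_false]
          have := hN F''
          omega
      · have h2 : v ∉ F' := fun h2 => by
          simp only [h1, h2, if_true, if_false] at hlt
          have := hN F
          omega
        simp only [h1, h2, if_false] at hlt
        obtain ⟨F'', hF'', hlt'', h⟩ := hf2 _ _ (hF.deletion h1) (hF'.deletion h2) hlt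
        refine ⟨F'', shedding _ hF'', ?_, h⟩
        simpa only [h1, (mem_deletion_singleton.1 hF''.1).2, if_false] using hlt''

theorem mem_generated {A : Set (Finset V)} {H : Finset V} :
    H ∈ generated A ↔ ∃ F ∈ A, H ⊆ F := mem_lowerClosure

theorem VertexDecomposable.empty_mem {Δ : Complex V} (h : VertexDecomposable Δ) : ∅ ∈ Δ := by
  cases h with
  | simplex _ h =>
    obtain ⟨S, hS⟩ := h
    exact (hS ∅).2 (Finset.empty_subset S)
  | shed _ _ v hv => exact Δ.lower (Finset.empty_subset {v}) hv

open Classical in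
theorem VertexDecomposable.shellable [Finite V] {Δ : Complex V} (h : VertexDecomposable Δ) :
    Shellable Δ := by
  obtain ⟨hpure, f, hf1, hf2⟩ := h.exists_isShellingOrder
  obtain ⟨F₀, hF₀, -⟩ := exists_isFacet_ge h.empty_mem
  have hcard : ∀ F, IsFacet Δ F → F.card = F₀.card := fun F hF => hpure F F₀ hF hF₀
  refine ⟨F₀.card - 1, ⟨⟨F₀, hF₀⟩, fun F hF => by rw [hcard F hF]⟩, ?_⟩
  have hfin : (f '' {F | IsFacet Δ F}).Finite := Set.toFinite _
  let o := hfin.toFinset.orderEmbOfFin rfl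
  have ho : ∀ i, ∃ F, IsFacet Δ F ∧ f F = o i := fun i => by
    have := hfin.toFinset.orderEmbOfFin_mem rfl i
    exact hfin.mem_toFinset.1 this
  choose F hF hfF using ho
  have hsurj : ∀ H, IsFacet Δ H → ∃ i, F i = H := fun H hH => by
    have : f H ∈ Set.range o := by
      rw [Finset.range_orderEmbOfFin]
      simpa using ⟨H, hH, rfl⟩
    obtain ⟨i, hi⟩ := this
    exact ⟨i, hf1 _ _ (hF i) hH ((hfF i).trans hi)⟩
  have hlt : ∀ i j, f (F i) < f (F j) ↔ i < j := fun i j => by rw [hfF, hfF, o.lt_iff_lt]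
  refine ⟨_, F, fun i j hij => o.injective (by rw [← hfF, ← hfF, hij]), fun H =>
    ⟨hsurj H, by rintro ⟨i, rfl⟩; exact hF i⟩, fun i hi => ?_⟩
  have hext : ∀ H, H ∈ generated {H | ∃ j < i, H = F j} ⊓ generated {F i} →
      ∃ H', H' ∈ generated {H | ∃ j < i, H = F j} ⊓ generated {F i} ∧ H ⊆ H' ∧
        H'.card + 1 = F₀.card := by
    rintro H ⟨h1, h2⟩
    obtain ⟨_, ⟨j, hj, rfl⟩, hHj⟩ := mem_generated.1 h1
    obtain ⟨_, rfl, hHi⟩ := mem_generated.1 h2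
    obtain ⟨F'', hF'', hlt'', H', h1', h2', h3', h4'⟩ :=
      hf2 (F i) (F j) (hF i) (hF j) ((hlt j i).2 hj)
    obtain ⟨k, rfl⟩ := hsurj F'' hF''
    exact ⟨H', ⟨mem_generated.2 ⟨F k, ⟨k, (hlt k i).1 hlt'', rfl⟩, h2'⟩,
      mem_generated.2 ⟨F i, rfl, h1'⟩⟩, fun u hu => h4' u (hHi hu) (hHj hu),
      by rw [h3', hcard _ (hF i)]⟩
  constructor
  -- The empty face is in the intersection, so a facet exists even when `d - 1 = -1`.
  · obtain ⟨F', hF', -⟩ := exists_isFacet_ge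
      (Δ := generated {H | ∃ j < i, H = F j} ⊓ generated {F i}) (H := ∅)
      ⟨mem_generated.2 ⟨_, ⟨⟨0, by omega⟩, hi, rfl⟩, Finset.empty_subset _⟩,
        mem_generated.2 ⟨F i, rfl, Finset.empty_subset _⟩⟩
    exact ⟨F', hF'⟩
  · intro H hH
    obtain ⟨H', hH', hle, hc⟩ := hext H hH.1
    have : H = H' := subset_antisymm hle (hH.2 hH' hle)
    rw [this, ← hc]
    push_cast
    ring

end Complexes

/-! ### Factors and nested sets -/

section BuildingSets

variable {L : Type*} [CompleteLattice L] {G : Set L}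

theorem IsBuildingSet.iSup_injective (hG : IsBuildingSet G) (F : L)
    {H H' : (x : factors G F) → Set.Iic (x : L)}
    (h : ⨆ x, (H x : L) = ⨆ x, (H' x : L)) : H = H' := by
  obtain ⟨e, he⟩ := hG.joinMap_iso F
  apply e.injective
  rw [he, he]
  exact Subtype.ext h

theorem IsBuildingSet.sSup_factors (hG : IsBuildingSet G) (F : L) :
    sSup (factors G F) = F := by
  obtain ⟨e, he⟩ := hG.joinMap_iso F
  have h := he (e.symm ⟨F, le_rfl⟩)
  rw [e.apply_symm_apply] at h
  refine le_antisymm (sSup_le fun x hx => hx.1.2) ?_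
  have h' : F = ⨆ x, ((e.symm ⟨F, le_rfl⟩) x : L) := congrArg Subtype.val h
  rw [h']
  exact iSup_le fun x => le_sSup_of_le (h' ▸ x.2) ((e.symm ⟨F, le_rfl⟩) x).2

theorem IsBuildingSet.exists_le_factor [Finite L] {g F : L} (hg : g ∈ G) (hgF : g ≤ F) :
    ∃ x ∈ factors G F, g ≤ x := by
  obtain ⟨x, hx, hm⟩ := (Set.toFinite {y | y ∈ G ∧ y ≤ F}).exists_le_maximal
    (show g ∈ {y | y ∈ G ∧ y ≤ F} from ⟨hg, hgF⟩)
  exact ⟨x, hm, hx⟩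

/-- Each factor of a join of members of `G` is the join of the members below it. -/
theorem IsBuildingSet.factor_eq_sSup [Finite L] (hG : IsBuildingSet G) {B : Set L} (hB : B ⊆ G)
    {x : L} (hx : x ∈ factors G (sSup B)) : sSup {b ∈ B | b ≤ x} = x := by
  -- Both families have join `sSup B`, since each member of `B` lies below some factor.
  have key := hG.iSup_injective (sSup B)
    (H := fun x => ⟨sSup {b ∈ B | b ≤ (x : L)}, sSup_le fun b hb => hb.2⟩)
    (H' := fun x => ⟨x, le_rfl⟩) (by
      apply le_antisymm
      · exact iSup_mono fun x => sSup_le fun b hb => hb.2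
      · have : ⨆ x : factors G (sSup B), (x : L) = sSup B := by
          rw [← sSup_eq_iSup', hG.sSup_factors]
        rw [this]
        refine sSup_le fun b hb => ?_
        obtain ⟨y, hy, hby⟩ := exists_le_factor (hB hb) (le_sSup hb)
        exact le_iSup_of_le (⟨y, hy⟩ : factors G (sSup B)) (le_sSup ⟨hb, hby⟩))
  exact congrArg Subtype.val (congrFun key ⟨x, hx⟩)

-- Placing `x ⊓ y` in the coordinate of `x` or in that of `y` gives the same join, against
-- injectivity unless it is `⊥`.
open Classical in
theorem IsBuildingSet.inf_factors (hG : IsBuildingSet G) {F x y : L} (hx : x ∈ factors G F)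
    (hy : y ∈ factors G F) (hxy : x ≠ y) : x ⊓ y = ⊥ := by
  have sup_single : ∀ (z : factors G F) (hz : x ⊓ y ≤ z),
      ⨆ u : factors G F, ((if h : u = z then ⟨x ⊓ y, h ▸ hz⟩ else ⊥ : Set.Iic (u : L)) : L) =
        x ⊓ y := by
    intro z hz
    apply le_antisymm
    · refine iSup_le fun u => ?_
      split_ifs
      · exact le_rfl
      · exact bot_le
    · exact le_iSup_of_le z (by rw [dif_pos rfl])
  have key := hG.iSup_injective F ((sup_single ⟨x, hx⟩ inf_le_left).trans
    (sup_single ⟨y, hy⟩ inf_le_right).symm)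
  have h := congrArg Subtype.val (congrFun key ⟨x, hx⟩)
  rw [dif_pos rfl, dif_neg (by simpa using hxy)] at h
  exact h

/-- The factors of `g ⊔ g'` above `g` and above `g'` meet nontrivially, so they coincide and equal
the join. -/
theorem IsBuildingSet.sup_mem [Finite L] (hG : IsBuildingSet G) {g g' : L} (hg : g ∈ G)
    (hg' : g' ∈ G) (h : g ⊓ g' ≠ ⊥) : g ⊔ g' ∈ G := by
  obtain ⟨x, hx, hgx⟩ := exists_le_factor hg (le_sup_left : g ≤ g ⊔ g')
  obtain ⟨y, hy, hgy⟩ := exists_le_factor hg' (le_sup_right : g' ≤ g ⊔ g')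
  by_cases hxy : x = y
  · subst hxy
    have : x = g ⊔ g' := le_antisymm hx.1.2 (sup_le hgx hgy)
    exact this ▸ hx.1.1
  · exact absurd (le_bot_iff.1 (hG.inf_factors hx hy hxy ▸ inf_le_inf hgx hgy)) h

theorem IsBuildingSet.ne_bot (hG : IsBuildingSet G) {g : L} (hg : g ∈ G) : g ≠ ⊥ :=
  fun h => hG.bot_notMem (h ▸ hg)

theorem IsBuildingSet.atom_mem (hG : IsBuildingSet G) {e : L} (he : IsAtom e) : e ∈ G := by
  have h := hG.sSup_factors e
  rcases (factors G e).eq_empty_or_nonempty with h0 | ⟨x, hx⟩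
  · rw [h0, sSup_empty] at h
    exact absurd h.symm he.1
  · rcases he.le_iff.1 hx.1.2 with h1 | h1
    · exact absurd h1 (hG.ne_bot hx.1.1)
    · exact h1 ▸ hx.1.1

/-- A subset of `G` is nested if and only if it contains the joins of its subsets that lie
in `G`. -/
theorem IsBuildingSet.isNested_iff (hG : IsBuildingSet G) {S : Finset L} :
    IsNested G S ↔ (S : Set L) ⊆ G ∧ ∀ B : Set L, B ⊆ S → sSup B ∈ G → sSup B ∈ B := by
  classical
  refine and_congr_right fun hS => ⟨fun h B hB hBG => ?_, fun h A hA hcard hanti hAG => ?_⟩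
  · have hfin : B.Finite := S.finite_toSet.subset hB
    -- The maximal elements of `B` form an antichain with the same join.
    have hMfin : {b | Maximal (· ∈ B) b}.Finite := hfin.subset fun b hb => hb.1
    have hsup : sSup {b | Maximal (· ∈ B) b} = sSup B := by
      apply le_antisymm (sSup_le_sSup fun b hb => hb.1)
      refine sSup_le fun b hb => ?_
      obtain ⟨m, hbm, hm⟩ := hfin.exists_le_maximal hb
      exact hbm.trans (le_sSup hm)
    have hn := h hMfin.toFinset (fun b hb => hB (by simpa using hb : Maximal (· ∈ B) b).1)
    rw [hMfin.coe_toFinset, hsup] at hn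
    rcases lt_or_ge hMfin.toFinset.card 2 with hlt | hge
    · rcases hMfin.toFinset.eq_empty_or_nonempty with h0 | ⟨m, hm⟩
      · have h1 : {b | Maximal (· ∈ B) b} = ∅ := by simpa using h0
        rw [← hsup, h1, sSup_empty] at hBG
        exact absurd hBG hG.bot_notMem
      · have h1 : {b | Maximal (· ∈ B) b} ⊆ {m} := fun b hb =>
          Finset.card_le_one.1 (by omega : hMfin.toFinset.card ≤ 1) b (by simpa using hb) m hm
        have h2 : Maximal (· ∈ B) m := by simpa using hm
        have h3 : sSup B = m := by
          rw [← hsup]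
          exact le_antisymm (sSup_le fun b hb => (h1 hb).le) (le_sSup h2)
        exact h3 ▸ h2.1
    · exact absurd hBG (hn hge (setOfPred_maximal_antichain _))
  · have hm := h A hA hAG
    obtain ⟨b, hb, hne⟩ := Finset.exists_mem_ne (by omega : 1 < A.card) (sSup (A : Set L))
    exact hanti hb hm hne (le_sSup hb)

theorem IsNested.mono {S S' : Finset L} (h : IsNested G S') (hS : S ⊆ S') : IsNested G S :=
  (fullNestedSetComplex G).lower hS h

/-- A factor of `sSup B` above `e` is a join of members of `B`, hence itself a member of `B` by
nestedness. -/
theorem IsNested.exists_le [Finite L] (hG : IsBuildingSet G) {S : Finset L} (hS : IsNested G S)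
    {B : Set L} (hB : B ⊆ S) {e : L} (he : e ∈ G) (heB : e ≤ sSup B) : ∃ b ∈ B, e ≤ b := by
  obtain ⟨x, hx, hex⟩ := IsBuildingSet.exists_le_factor he heB
  have h := hG.factor_eq_sSup (hB.trans hS.1) hx
  have hm := (hG.isNested_iff.1 hS).2 {b ∈ B | b ≤ x} (fun b hb => hB hb.1) (h.symm ▸ hx.1.1)
  rw [h] at hm
  exact ⟨x, hm.1, hex⟩

theorem IsNested.comparable [Finite L] (hG : IsBuildingSet G) {S : Finset L} (hS : IsNested G S)
    {x y e : L} (hx : x ∈ S) (hy : y ∈ S) (he : e ≠ ⊥) (hex : e ≤ x) (hey : e ≤ y) :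
    x ≤ y ∨ y ≤ x := by
  have hm : x ⊔ y ∈ G := hG.sup_mem (hS.1 hx) (hS.1 hy)
    (fun h => he (le_bot_iff.1 (h ▸ le_inf hex hey)))
  have := (hG.isNested_iff.1 hS).2 {x, y} (by
    intro z hz
    rcases hz with rfl | rfl <;> assumption) (by rwa [sSup_pair])
  rw [sSup_pair] at this
  rcases this with h | h
  · exact .inr (sup_eq_left.1 h)
  · exact .inl (sup_eq_right.1 h)

/-- The join of the members of `T` strictly below `s` and the members of `A` below `s`. -/
def gen (T A : Set L) (s : L) : L := sSup ({t ∈ T | t < s} ∪ {a ∈ A | a ≤ s})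

theorem gen_le_iff {T A : Set L} {s u : L} :
    gen T A s ≤ u ↔ (∀ t ∈ T, t < s → t ≤ u) ∧ ∀ a ∈ A, a ≤ s → a ≤ u := by
  simp [gen, or_imp, forall_and]

theorem gen_le (T A : Set L) (s : L) : gen T A s ≤ s :=
  gen_le_iff.2 ⟨fun _ _ h => h.le, fun _ _ h => h⟩

theorem le_gen_left {T A : Set L} {s t : L} (ht : t ∈ T) (h : t < s) : t ≤ gen T A s :=
  le_sSup (.inl ⟨ht, h⟩)

theorem le_gen_right {T A : Set L} {s a : L} (ha : a ∈ A) (h : a ≤ s) : a ≤ gen T A s :=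
  le_sSup (.inr ⟨ha, h⟩)

theorem gen_mono {T T' A A' : Set L} {s s' : L} (hT : T ⊆ T') (hA : A ⊆ A') (hs : s ≤ s') :
    gen T A s ≤ gen T' A' s' :=
  gen_le_iff.2 ⟨fun _ ht h => le_gen_left (hT ht) (h.trans_le hs),
    fun _ ha h => le_gen_right (hA ha) (h.trans hs)⟩

theorem IsNested.gen_empty_lt (hG : IsBuildingSet G) {S : Finset L} (hS : IsNested G S)
    {T : Set L} (hT : T ⊆ S) {s : L} (hs : s ∈ S) : gen T ∅ s < s := by
  refine lt_of_le_of_ne (gen_le _ _ _) fun h => ?_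
  have h' : sSup {t ∈ T | t < s} = s := by simpa [gen] using h
  have := (hG.isNested_iff.1 hS).2 {t ∈ T | t < s} (fun t ht => hT ht.1) (h'.symm ▸ hS.1 hs)
  rw [h'] at this
  exact lt_irrefl _ this.2

open Classical in
/-- A nested set stays nested when the factors of `w < t` are added, where `w` is above all its
members strictly below its member `t`. -/
theorem IsNested.union_factors [Finite L] (hG : IsBuildingSet G) {S W : Finset L}
    (hS : IsNested G S) {t w : L} (ht : t ∈ S) (hw : w < t) (hSw : ∀ r ∈ S, r < t → r ≤ w)
    (hW : (W : Set L) = factors G w) : IsNested G (S ∪ W) := by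
  have hWmem : ∀ x, x ∈ W ↔ x ∈ factors G w := fun x => by rw [← hW]; simp
  rw [hG.isNested_iff] at hS ⊢
  have hsub : ((S ∪ W : Finset L) : Set L) ⊆ G := by
    intro x hx
    rcases Finset.mem_union.1 hx with h | h
    · exact hS.1 h
    · exact ((hWmem x).1 h).1.1
  refine ⟨hsub, fun B hB hBG => ?_⟩
  by_cases hBS : B ⊆ S
  · exact hS.2 B hBS hBG
  obtain ⟨g, hgB, hgS⟩ := Set.not_subset.1 hBS
  have hgW : g ∈ factors G w := by
    rcases Finset.mem_union.1 (hB hgB) with h | h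
    · exact absurd h hgS
    · exact (hWmem g).1 h
  by_cases hBw : sSup B ≤ w
  · have : sSup B = g := le_antisymm (hgW.2 ⟨hBG, hBw⟩ (le_sSup hgB)) (le_sSup hgB)
    exact this ▸ hgB
  -- Joining with `t` absorbs the members of `B` below `w`, leaving a subset of `S` to which
  -- nestedness applies.
  have hC : sSup (insert t {b ∈ B | ¬ b ≤ w}) = sSup B ⊔ t := by
    apply le_antisymm
    · refine sSup_le ?_
      rintro b (rfl | hb)
      · exact le_sup_right
      · exact le_sup_of_le_left (le_sSup hb.1)
    · refine sup_le (sSup_le fun b hb => ?_) (le_sSup (.inl rfl))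
      by_cases h : b ≤ w
      · exact (h.trans hw.le).trans (le_sSup (.inl rfl))
      · exact le_sSup (.inr ⟨hb, h⟩)
  have hBS' : ∀ b ∈ B, ¬ b ≤ w → b ∈ S := fun b hb h => by
    rcases Finset.mem_union.1 (hB hb) with h' | h'
    · exact h'
    · exact absurd ((hWmem b).1 h').1.2 h
  have hCG : sSup B ⊔ t ∈ G := hG.sup_mem hBG (hS.1 ht) fun h =>
    hG.ne_bot hgW.1.1 (le_bot_iff.1 (h ▸ le_inf (le_sSup hgB) (hgW.1.2.trans hw.le)))
  have hmem := hS.2 (insert t {b ∈ B | ¬ b ≤ w}) (by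
    rintro b (rfl | hb)
    · exact ht
    · exact hBS' b hb.1 hb.2) (hC.symm ▸ hCG)
  rw [hC] at hmem
  rcases hmem with h | h
  · have hBt : sSup B ≤ t := sup_eq_right.1 h
    have : ∃ b ∈ B, ¬ b ≤ w := by
      by_contra! hcon
      exact hBw (sSup_le hcon)
    obtain ⟨b, hb, hbw⟩ := this
    have hbt : b = t := by
      by_contra hne
      exact hbw (hSw b (hBS' b hb hbw) (lt_of_le_of_ne ((le_sSup hb).trans hBt) hne))
    have : sSup B = t := le_antisymm hBt (hbt ▸ le_sSup hb)
    exact this ▸ hbt ▸ hb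
  · have : sSup B ⊔ t = sSup B := le_antisymm (le_sSup h.1) le_sup_left
    exact this ▸ h.1

end BuildingSets

/-! ### Relative complexes and the induction on atoms -/

open Classical in
/-- The complex of the sets `S` disjoint from `K` with `S ∪ T` nested and the members of `S`
taken from `U ∪ T`. -/
def relativeComplex {L : Type*} [CompleteLattice L] (G : Set L) (K T : Finset L) (U : Set L) :
    Complex L where
  carrier := {S | Disjoint S K ∧ IsNested G (S ∪ T) ∧ ∀ s ∈ S, s ∈ U ∨ s ∈ T}
  lower' := fun _ _ hle h => ⟨h.1.mono_left hle,
    h.2.1.mono (Finset.union_subset_union_left hle), fun s hs => h.2.2 s (hle hs)⟩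

section Geometric

variable {L : Type*} [CompleteLattice L]

/-- A nested set `T` that contains the maximal members of `G` and each of whose members `t` is
either generated by the members of `T` below it and `A`, or has rank one over the join of the
former. -/
structure IsGood (G : Set L) (rk : L → ℕ) (K T : Finset L) (A : Set L) : Prop where
  subset : K ⊆ T
  nested : IsNested G T
  max_mem : ∀ x, Maximal (· ∈ G) x → x ∈ T
  gen_or : ∀ t ∈ T, gen T A t = t ∨ rk t = rk (gen T ∅ t) + 1

variable {G : Set L} {rk : L → ℕ}

theorem factors_top (G : Set L) : factors G ⊤ = {x | Maximal (· ∈ G) x} := by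
  ext x
  simp [factors]

open Classical in
theorem mem_relativeComplex {K T S : Finset L} {U : Set L} :
    S ∈ relativeComplex G K T U ↔
      Disjoint S K ∧ IsNested G (S ∪ T) ∧ ∀ s ∈ S, s ∈ U ∨ s ∈ T := Iff.rfl

-- A rank gap of one leaves no room for `gen T ∅ t` to grow while staying below `t`.
open Classical in
theorem IsGood.insert_vertex (hG : IsBuildingSet G) (hrk : StrictMono rk) {K T : Finset L}
    {A : Set L} (h : IsGood G rk K T A) {x : L} (hx : IsNested G (insert x T))
    (hxgen : gen T A x = x) : IsGood G rk (insert x K) (insert x T) A := by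
  have hTx : (T : Set L) ⊆ (insert x T : Finset L) := Finset.coe_subset.2 (Finset.subset_insert x T)
  have hmono : ∀ s, gen T A s = s → gen (insert x T : Finset L) A s = s := fun s hs =>
    le_antisymm (gen_le _ _ _) (hs.ge.trans (gen_mono hTx le_rfl le_rfl))
  refine ⟨Finset.insert_subset_insert x h.subset, hx,
    fun y hy => Finset.mem_insert_of_mem (h.max_mem y hy), fun t ht => ?_⟩
  rcases Finset.mem_insert.1 ht with rfl | htT
  · exact .inl (hmono _ hxgen)
  rcases h.gen_or t htT with h1 | h1
  · exact .inl (hmono _ h1)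
  · right
    rw [h1]
    congr 2
    refine (gen_mono hTx le_rfl le_rfl : gen T ∅ t ≤ _).eq_of_not_lt fun hlt => ?_
    have h2 := hrk hlt
    have h3 := hrk (hx.gen_empty_lt hG le_rfl ht)
    omega

variable [Finite L]

-- Building up a lower set of `T` one maximal member at a time, each new member raises the join by
-- exactly one atom.
open Classical in
theorem IsNested.card_eq_rk [IsAtomistic L] (hG : IsBuildingSet G) (hrk : StrictMono rk)
    (hbot : rk ⊥ = 0) (hatom : ∀ x e, IsAtom e → rk (x ⊔ e) ≤ rk x + 1) {T : Finset L}
    (hT : IsNested G T) (hcov : ∀ t ∈ T, rk t = rk (gen T ∅ t) + 1) (n : ℕ) :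
    ∀ T' ⊆ T, (∀ t ∈ T, ∀ t' ∈ T', t ≤ t' → t ∈ T') → T'.card = n →
      rk (sSup (T' : Set L)) = n := by
  induction n with
  | zero =>
    intro T' _ _ h
    rw [Finset.card_eq_zero.1 h]
    simpa using hbot
  | succ n ih =>
    intro T' hT' hlow hcard
    obtain ⟨t, ht⟩ := T'.exists_maximal (Finset.card_pos.1 (by omega))
    have hcard' : (T'.erase t).card = n := by
      rw [Finset.card_erase_of_mem ht.1, hcard, Nat.add_sub_cancel]
    have hih := ih (T'.erase t) ((Finset.erase_subset t T').trans hT') (fun s hs s' hs' hle => by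
      refine Finset.mem_erase.2 ⟨?_, hlow s hs s' (Finset.mem_of_mem_erase hs') hle⟩
      rintro rfl
      exact Finset.ne_of_mem_erase hs' (le_antisymm (ht.2 (Finset.mem_of_mem_erase hs') hle) hle))
      hcard'
    have hwt : gen T ∅ t < t := hT.gen_empty_lt hG le_rfl (hT' ht.1)
    obtain ⟨e, he, het, hew⟩ : ∃ e, IsAtom e ∧ e ≤ t ∧ ¬ e ≤ gen T ∅ t := by
      by_contra! hcon
      exact hwt.not_ge (le_iff_atom_le_imp.2 hcon)
    have hte : t = gen T ∅ t ⊔ e := by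
      by_contra hne
      have h1 : gen T ∅ t ⊔ e < t := lt_of_le_of_ne (sup_le hwt.le het) (Ne.symm hne)
      have h2 : gen T ∅ t < gen T ∅ t ⊔ e := left_lt_sup.2 hew
      have := hrk h1
      have := hrk h2
      have := hcov t (hT' ht.1)
      omega
    have hwsup : gen T ∅ t ≤ sSup (T'.erase t : Set L) := by
      refine gen_le_iff.2 ⟨fun s hs hst => le_sSup ?_, fun a ha => absurd ha (by simp)⟩
      exact Finset.mem_coe.2 (Finset.mem_erase.2 ⟨hst.ne, hlow s hs t ht.1 hst.le⟩)
    have hsup : sSup (T' : Set L) = sSup (T'.erase t : Set L) ⊔ e := by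
      have : sSup (T' : Set L) = t ⊔ sSup (T'.erase t : Set L) := by
        rw [← sSup_insert, ← Finset.coe_insert, Finset.insert_erase ht.1]
      rw [this]
      apply le_antisymm
      · refine sup_le ?_ le_sup_left
        exact hte.le.trans (sup_le_sup_right hwsup e)
      · exact sup_le le_sup_right (le_sup_of_le_left het)
    -- Otherwise `e` is below another member of `T'`, which is comparable to `t` and so strictly
    -- below it; then `e ≤ gen T ∅ t`.
    have hnle : ¬ e ≤ sSup (T'.erase t : Set L) := by
      intro hle
      obtain ⟨b, hb, heb⟩ := hT.exists_le hG
        (Finset.coe_subset.2 ((Finset.erase_subset t T').trans hT')) (hG.atom_mem he) hle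
      have hb' := Finset.mem_erase.1 (Finset.mem_coe.1 hb)
      have hbt : b ≤ t := by
        rcases hT.comparable hG (hT' hb'.2) (hT' ht.1) he.1 heb het with h | h
        · exact h
        · exact ht.2 hb'.2 h
      exact hew (heb.trans (le_gen_left (hT' hb'.2) (lt_of_le_of_ne hbt hb'.1)))
    have h1 := hrk (left_lt_sup.2 hnle)
    have h2 := hatom (sSup (T'.erase t : Set L)) e he
    rw [hsup]
    omega

-- With no atoms, nestedness forbids any generated vertex outside `T`.
open Classical in
theorem IsGood.vertexDecomposable_empty [IsAtomistic L] (hG : IsBuildingSet G)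
    (hrk : StrictMono rk) (hbot : rk ⊥ = 0)
    (hatom : ∀ x e, IsAtom e → rk (x ⊔ e) ≤ rk x + 1) {K T : Finset L}
    (h : IsGood G rk K T ∅) :
    VertexDecomposable (relativeComplex G K T {s | gen T ∅ s = s}) ∧
      ∀ F, IsFacet (relativeComplex G K T {s | gen T ∅ s = s}) F → F.card + K.card = rk ⊤ := by
  have hmem : ∀ H, H ∈ relativeComplex G K T {s | gen T ∅ s = s} ↔ H ⊆ T \ K := by
    intro H
    constructor
    · rintro ⟨h1, h2, h3⟩ s hs
      refine Finset.mem_sdiff.2 ⟨?_, Finset.disjoint_left.1 h1 hs⟩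
      rcases h3 s hs with h4 | h4
      · exact absurd h4 (h2.gen_empty_lt hG (Finset.coe_subset.2 Finset.subset_union_right)
          (Finset.mem_union_left T hs)).ne
      · exact h4
    · intro hH
      have hHT : H ⊆ T := hH.trans Finset.sdiff_subset
      refine ⟨Finset.disjoint_left.2 fun s hs => (Finset.mem_sdiff.1 (hH hs)).2, ?_,
        fun s hs => .inr (hHT hs)⟩
      rw [Finset.union_eq_right.2 hHT]
      exact h.nested
  refine ⟨.simplex _ ⟨_, hmem⟩, fun F hF => ?_⟩
  have hFeq : F = T \ K :=
    subset_antisymm ((hmem F).1 hF.1) (hF.2 ((hmem _).2 le_rfl) ((hmem F).1 hF.1))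
  rw [hFeq, Finset.card_sdiff_add_card_eq_card h.subset]
  have hT := h.nested.card_eq_rk hG hrk hbot hatom (fun t ht => (h.gen_or t ht).resolve_left
    (h.nested.gen_empty_lt hG le_rfl ht).ne) T.card T le_rfl (fun t ht _ _ _ => ht) rfl
  have htop : sSup (T : Set L) = ⊤ := by
    rw [eq_top_iff, ← hG.sSup_factors ⊤, factors_top]
    exact sSup_le_sSup h.max_mem
  rw [← hT, htop]

-- Factors of `gen T A t` outside `T` are already generated by `T` and `A`, and are compatible with
-- every face, whose members below `t` lie below `gen T A t`.
open Classical in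
theorem IsGood.relativeComplex_union_factors (hG : IsBuildingSet G) {K T W : Finset L}
    {A : Set L} (hA : A ⊆ G) (hT : IsNested G T) {t : L} (ht : t ∈ T) (hlt : gen T A t < t)
    (hW : (W : Set L) = factors G (gen T A t)) :
    (∀ g ∈ W, g ∈ T ∨ gen T A g = g) ∧
    relativeComplex G K T {s | gen T A s = s} =
      relativeComplex G K (T ∪ W) {s | gen (T ∪ W : Finset L) A s = s} := by
  have hWT : ∀ g ∈ W, g ∈ T ∨ gen T A g = g := by
    intro g hg
    by_cases hgT : g ∈ T
    · exact .inl hgT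
    refine .inr (le_antisymm (gen_le _ _ _) ?_)
    have hg' : g ∈ factors G (gen T A t) := hW ▸ Finset.mem_coe.2 hg
    rw [← hG.factor_eq_sSup (by
      rintro b (hb | hb)
      · exact hT.1 hb.1
      · exact hA hb.1) hg']
    conv_rhs => rw [hG.factor_eq_sSup (by
      rintro b (hb | hb)
      · exact hT.1 hb.1
      · exact hA hb.1) hg']
    refine sSup_le ?_
    rintro b ⟨hb | hb, hbg⟩
    · exact le_gen_left hb.1 (lt_of_le_of_ne hbg fun h => hgT (h ▸ hb.1))
    · exact le_gen_right hb.1 hbg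
  refine ⟨hWT, ?_⟩
  have hTW : (T : Set L) ⊆ (T ∪ W : Finset L) := Finset.coe_subset.2 Finset.subset_union_left
  ext S
  constructor
  · rintro ⟨h1, h2, h3⟩
    refine ⟨h1, ?_, fun s hs => ?_⟩
    · rw [← Finset.union_assoc]
      refine h2.union_factors hG (Finset.mem_union_right S ht) hlt (fun r hr hrt => ?_) hW
      have hr' : gen T A r = r ∨ r ∈ T := (Finset.mem_union.1 hr).elim (h3 r) .inr
      rcases hr' with h | h
      · exact h.ge.trans (gen_mono le_rfl le_rfl hrt.le)
      · exact le_gen_left h hrt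
    · rcases h3 s hs with h | h
      · exact .inl (le_antisymm (gen_le _ _ _) (h.ge.trans (gen_mono hTW le_rfl le_rfl)))
      · exact .inr (Finset.mem_union_left W h)
  · rintro ⟨h1, h2, h3⟩
    refine ⟨h1, h2.mono (Finset.union_subset_union_right Finset.subset_union_left),
      fun s hs => ?_⟩
    rcases h3 s hs with h | h
    · refine .inl (le_antisymm (gen_le _ _ _) (h.ge.trans (gen_le_iff.2 ⟨fun r hr hrs => ?_,
        fun a ha has => le_gen_right ha has⟩)))
      by_cases hrT : r ∈ T
      · exact le_gen_left hrT hrs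
      · have hrW := (Finset.mem_union.1 (Finset.mem_coe.1 hr)).resolve_left hrT
        exact ((hWT r hrW).resolve_left hrT).ge.trans (gen_mono le_rfl le_rfl hrs.le)
    · rcases Finset.mem_union.1 h with h | h
      · exact .inr h
      · exact (hWT s h).symm

open Classical in
/-- If `T` is good for `A ∪ {e}`, then the complex of the sets generated by `A` is not changed
by a suitable passage to a larger set that is good for `A`. -/
theorem IsGood.exists_of_insert (hG : IsBuildingSet G) (hrk : StrictMono rk)
    (hatom : ∀ x e, IsAtom e → rk (x ⊔ e) ≤ rk x + 1) {K T : Finset L} {A : Set L} {e : L}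
    (he : IsAtom e) (hA : A ⊆ G) (h : IsGood G rk K T (insert e A)) :
    ∃ T', IsGood G rk K T' A ∧
      relativeComplex G K T {s | gen T A s = s} = relativeComplex G K T' {s | gen T' A s = s} := by
  by_cases hgood : ∀ t ∈ T, gen T A t = t ∨ rk t = rk (gen T ∅ t) + 1
  · exact ⟨T, ⟨h.subset, h.nested, h.max_mem, hgood⟩, rfl⟩
  push Not at hgood
  obtain ⟨t, ht, hne, hrkt⟩ := hgood
  have hlt : gen T A t < t := lt_of_le_of_ne (gen_le _ _ _) hne
  have hgen : gen T (insert e A) t = t := (h.gen_or t ht).resolve_right hrkt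
  have het : e ≤ t := by
    by_contra het
    refine hlt.not_ge (hgen.ge.trans (gen_le_iff.2 ⟨fun _ hs hst => le_gen_left hs hst, ?_⟩))
    rintro a (rfl | ha) hat
    · exact absurd hat het
    · exact le_gen_right ha hat
  have hte : t ≤ gen T A t ⊔ e := by
    refine hgen.ge.trans (gen_le_iff.2 ⟨fun _ hs hst => le_sup_of_le_left (le_gen_left hs hst), ?_⟩)
    rintro a (rfl | ha) hat
    · exact le_sup_right
    · exact le_sup_of_le_left (le_gen_right ha hat)
  have hew : ¬ e ≤ gen T A t := fun hew => hlt.not_ge (hte.trans (sup_le le_rfl hew))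
  have hrkw : rk t = rk (gen T A t) + 1 := by
    have h1 := hrk hlt
    have h2 := hatom (gen T A t) e he
    have h3 := hrk.monotone hte
    omega
  obtain ⟨W, hW⟩ : ∃ W : Finset L, (W : Set L) = factors G (gen T A t) :=
    ⟨(Set.toFinite _).toFinset, Set.Finite.coe_toFinset _⟩
  obtain ⟨hWT, heq⟩ := relativeComplex_union_factors (K := K) hG hA h.nested ht hlt hW
  refine ⟨T ∪ W, ⟨h.subset.trans Finset.subset_union_left, ?_,
    fun x hx => Finset.mem_union_left W (h.max_mem x hx), fun s hs => ?_⟩, heq⟩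
  · exact h.nested.union_factors hG ht hlt (fun r hr hrt => le_gen_left hr hrt) hW
  have hnest : IsNested G (T ∪ W) :=
    h.nested.union_factors hG ht hlt (fun r hr hrt => le_gen_left hr hrt) hW
  have hTW : (T : Set L) ⊆ (T ∪ W : Finset L) := Finset.coe_subset.2 Finset.subset_union_left
  by_cases hsT : s ∈ T
  · rcases eq_or_ne s t with rfl | hst
    -- All of `W` is strictly below `t`, so the members of `T ∪ W` below `t` have join `gen T A t`,
    -- of rank one less.
    · right
      rw [hrkw]
      congr 2
      apply le_antisymm
      · rw [← hG.sSup_factors (gen T A s), ← hW]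
        refine sSup_le fun g hg => ?_
        have hg' : g ∈ factors G (gen T A s) := hW ▸ hg
        exact le_gen_left (Finset.mem_coe.2 (Finset.mem_union_right T (Finset.mem_coe.1 hg)))
          (hg'.1.2.trans_lt hlt)
      · refine gen_le_iff.2 ⟨fun r hr hrs => ?_, fun a ha => absurd ha (by simp)⟩
        rcases Finset.mem_union.1 (Finset.mem_coe.1 hr) with hr | hr
        · exact le_gen_left hr hrs
        · have hr' : r ∈ factors G (gen T A s) := hW ▸ Finset.mem_coe.2 hr
          exact hr'.1.2
    · rcases h.gen_or s hsT with hs' | hs'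
      · left
        refine le_antisymm (gen_le _ _ _) (hs'.ge.trans (gen_le_iff.2
          ⟨fun r hr hrs => le_gen_left (hTW hr) hrs, ?_⟩))
        rintro a (rfl | ha) has
        -- Both `s` and `t` are above `e`, hence comparable: `s < t` would put `e` below `gen T A
        -- t`, and if `t < s` then `t` replaces `e`. So `t` is the only member to repair.
        · rcases h.nested.comparable hG hsT ht he.1 has het with hle | hle
          · exact absurd (has.trans (le_gen_left hsT (lt_of_le_of_ne hle hst))) hew
          · exact het.trans (le_gen_left (hTW ht) (lt_of_le_of_ne hle hst.symm))
        · exact le_gen_right ha has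
      · right
        rw [hs']
        congr 2
        have h1 : gen T ∅ s ≤ gen (T ∪ W : Finset L) ∅ s := gen_mono hTW le_rfl le_rfl
        refine h1.eq_of_not_lt fun hlt' => ?_
        have h2 := hrk hlt'
        have h3 := hrk (hnest.gen_empty_lt hG le_rfl hs)
        omega
  · have hsW := (Finset.mem_union.1 hs).resolve_left hsT
    exact .inl (le_antisymm (gen_le _ _ _) (((hWT s hsW).resolve_left hsT).ge.trans
      (gen_mono hTW le_rfl le_rfl)))

-- Minimality puts the other members of `X` in a face with `x` above `x`, where `x` replaces `e` as
-- a generator. Conversely, a vertex that needs `x` as a generator lies above `x`, and `hup` returns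
-- it to `X`.
open Classical in
theorem IsGood.link_relativeComplex (hG : IsBuildingSet G) {K T X : Finset L} {A : Set L} {e : L}
    (he : IsAtom e) (h : IsGood G rk K T (insert e A))
    (hX : ∀ x ∈ X, x ∉ T ∧ IsNested G (insert x T) ∧ gen T (insert e A) x = x ∧ gen T A x ≠ x)
    (hup : ∀ x ∈ X, ∀ y, y ∉ T → IsNested G (insert y T) → gen T (insert e A) y = y →
      gen T A y ≠ y → x ≤ y → y ∈ X) {x : L} (hx : Minimal (· ∈ X) x) :
    link (relativeComplex G K T ({s | gen T A s = s} ∪ X)) {x} =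
      relativeComplex G (insert x K) (insert x T)
        {s | gen (insert x T : Finset L) A s = s} := by
  have e_le : ∀ s, gen T (insert e A) s = s → gen T A s ≠ s → e ≤ s := fun s h1 h2 => by
    by_contra hes
    refine h2 (le_antisymm (gen_le _ _ _) (h1.ge.trans (gen_le_iff.2
      ⟨fun _ hr hrs => le_gen_left hr hrs, ?_⟩)))
    rintro a (rfl | ha) has
    · exact absurd has hes
    · exact le_gen_right ha has
  have hTx : (T : Set L) ⊆ (insert x T : Finset L) := Finset.coe_subset.2 (Finset.subset_insert x T)
  obtain ⟨hxT, hxnest, hxgen, hxne⟩ := hX x hx.1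
  have hex := e_le x hxgen hxne
  have hunion : ∀ S : Finset L, insert x S ∪ T = S ∪ insert x T := fun S => by
    rw [Finset.insert_union, Finset.union_insert]
  ext S
  refine Iff.trans (mem_link_singleton (H := S)) ?_
  refine Iff.trans ?_ (mem_relativeComplex (S := S)).symm
  rw [mem_relativeComplex, hunion, Finset.disjoint_insert_left, Finset.disjoint_insert_right]
  constructor
  · rintro ⟨hxS, ⟨-, hSK⟩, hnest, hmem⟩
    refine ⟨⟨hxS, hSK⟩, hnest, fun s hs => ?_⟩
    rcases hmem s (Finset.mem_insert_of_mem hs) with (h1 | h1) | h1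
    · exact .inl (le_antisymm (gen_le _ _ _) (Eq.ge h1 |>.trans (gen_mono hTx le_rfl le_rfl)))
    · obtain ⟨hsT, -, hsgen, hsne⟩ := hX s h1
      have hes := e_le s hsgen hsne
      have hsx : s ≠ x := fun h => hxS (h ▸ hs)
      have hxs : x ≤ s := by
        rcases hnest.comparable hG (Finset.mem_union_left _ hs)
          (Finset.mem_union_right _ (Finset.mem_insert_self x T)) he.1 hes hex with h2 | h2
        · exact hx.2 h1 h2
        · exact h2
      refine .inl (le_antisymm (gen_le _ _ _) (hsgen.ge.trans (gen_le_iff.2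
        ⟨fun _ hr hrs => le_gen_left (hTx hr) hrs, ?_⟩)))
      rintro a (rfl | ha) has
      · exact hex.trans (le_gen_left (Finset.mem_coe.2 (Finset.mem_insert_self x T))
          (lt_of_le_of_ne hxs hsx.symm))
      · exact le_gen_right ha has
    · exact .inr (Finset.mem_insert_of_mem h1)
  · rintro ⟨⟨hxS, hSK⟩, hnest, hmem⟩
    refine ⟨hxS, ⟨fun hxK => hxT (h.subset hxK), hSK⟩, hnest, fun s hs => ?_⟩
    rcases Finset.mem_insert.1 hs with rfl | hsS
    · exact .inl (.inr hx.1)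
    rcases hmem s hsS with h1 | h1
    · by_cases hsT : s ∈ T
      · exact .inr hsT
      by_cases hsA : gen T A s = s
      · exact .inl (.inl hsA)
      have hxs : x < s := by
        by_contra hxs
        refine hsA (le_antisymm (gen_le _ _ _) (Eq.ge h1 |>.trans (gen_le_iff.2
          ⟨fun r hr hrs => ?_, fun a ha has => le_gen_right ha has⟩)))
        rcases Finset.mem_insert.1 (Finset.mem_coe.1 hr) with rfl | hr
        · exact absurd hrs hxs
        · exact le_gen_left hr hrs
      refine .inl (.inr (hup x hx.1 s hsT (hnest.mono ?_) ?_ hsA hxs.le))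
      · refine Finset.insert_subset (Finset.mem_union_left _ hsS) ?_
        exact (Finset.subset_insert x T).trans Finset.subset_union_right
      · refine le_antisymm (gen_le _ _ _) (Eq.ge h1 |>.trans (gen_le_iff.2
          ⟨fun r hr hrs => ?_, fun a ha has => le_gen_right (.inr ha) has⟩))
        rcases Finset.mem_insert.1 (Finset.mem_coe.1 hr) with rfl | hr
        · exact hxgen.ge.trans (gen_mono le_rfl le_rfl hxs.le)
        · exact le_gen_left hr hrs
    · rcases Finset.mem_insert.1 h1 with rfl | h1
      · exact absurd hsS hxS
      · exact .inr h1

open Classical in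
theorem IsGood.vertexDecomposable [IsAtomistic L] (hG : IsBuildingSet G)
    (hrk : StrictMono rk) (hbot : rk ⊥ = 0)
    (hatom : ∀ x e, IsAtom e → rk (x ⊔ e) ≤ rk x + 1) (A : Finset L) (hA : ∀ a ∈ A, IsAtom a) :
    ∀ {K T : Finset L}, IsGood G rk K T A →
      VertexDecomposable (relativeComplex G K T {s | gen T A s = s}) ∧
        ∀ F, IsFacet (relativeComplex G K T {s | gen T A s = s}) F →
          F.card + K.card = rk ⊤ := by
  induction A using Finset.induction_on with
  | empty =>
    intro K T h
    rw [Finset.coe_empty] at h ⊢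
    exact h.vertexDecomposable_empty hG hrk hbot hatom
  | insert e A heA ih =>
    have he : IsAtom e := hA e (Finset.mem_insert_self e A)
    have hA' : ∀ a ∈ A, IsAtom a := fun a ha => hA a (Finset.mem_insert_of_mem ha)
    rw [Finset.coe_insert]
    have base : ∀ {K T : Finset L}, IsGood G rk K T (insert e (A : Set L)) →
        VertexDecomposable (relativeComplex G K T {s | gen T A s = s}) ∧
          ∀ F, IsFacet (relativeComplex G K T {s | gen T A s = s}) F →
            F.card + K.card = rk ⊤ := fun h => by
      obtain ⟨T', h', heq⟩ := h.exists_of_insert hG hrk hatom he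
        (fun a ha => hG.atom_mem (hA' a ha))
      rw [heq]
      exact ih hA' h'
    intro K T h
    -- `X` holds the vertices not yet shed; it stays closed upwards because minimal ones go first.
    have step : ∀ (n : ℕ) (X : Finset L), X.card = n →
        (∀ x ∈ X, x ∉ T ∧ IsNested G (insert x T) ∧ gen T (insert e (A : Set L)) x = x ∧
          gen T A x ≠ x) →
        (∀ x ∈ X, ∀ y, y ∉ T → IsNested G (insert y T) → gen T (insert e (A : Set L)) y = y →
          gen T A y ≠ y → x ≤ y → y ∈ X) →
        VertexDecomposable (relativeComplex G K T ({s | gen T A s = s} ∪ X)) ∧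
          ∀ F, IsFacet (relativeComplex G K T ({s | gen T A s = s} ∪ X)) F →
            F.card + K.card = rk ⊤ := by
      intro n
      induction n with
      | zero =>
        intro X hX _ _
        rw [Finset.card_eq_zero.1 hX, Finset.coe_empty, Set.union_empty]
        exact base h
      | succ n ihn =>
        intro X hcard hX hup
        obtain ⟨x, hx⟩ := X.exists_minimal (Finset.card_pos.1 (by omega))
        obtain ⟨hxT, hxnest, hxgen, hxne⟩ := hX x hx.1
        have hdel : deletion (relativeComplex G K T ({s | gen T A s = s} ∪ X)) {x} =
            relativeComplex G K T ({s | gen T A s = s} ∪ (X.erase x : Finset L)) := by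
          ext S
          refine Iff.trans (mem_deletion_singleton (H := S)) ?_
          refine Iff.trans ?_ (mem_relativeComplex (S := S)).symm
          rw [mem_relativeComplex]
          constructor
          · rintro ⟨⟨h1, h2, h3⟩, h4⟩
            refine ⟨h1, h2, fun s hs => (h3 s hs).imp_left (Or.imp_right fun h5 => ?_)⟩
            exact Finset.mem_coe.2 (Finset.mem_erase.2 ⟨fun h => h4 (h ▸ hs), h5⟩)
          · rintro ⟨h1, h2, h3⟩
            refine ⟨⟨h1, h2, fun s hs => (h3 s hs).imp_left (Or.imp_right
              fun h5 => Finset.mem_of_mem_erase (Finset.mem_coe.1 h5))⟩, fun hxS => ?_⟩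
            rcases h3 x hxS with (h5 | h5) | h5
            · exact hxne h5
            · exact Finset.ne_of_mem_erase (Finset.mem_coe.1 h5) rfl
            · exact hxT h5
        have hlk := h.link_relativeComplex hG he hX hup hx
        obtain ⟨hd1, hd2⟩ := ihn (X.erase x)
          (by rw [Finset.card_erase_of_mem hx.1, hcard, Nat.add_sub_cancel])
          (fun y hy => hX y (Finset.mem_of_mem_erase hy))
          (fun y hy z h1 h2 h3 h4 hyz => Finset.mem_erase.2 ⟨fun hzx =>
            Finset.ne_of_mem_erase hy (le_antisymm (hzx ▸ hyz)
              (hx.2 (Finset.mem_of_mem_erase hy) (hzx ▸ hyz))),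
            hup y (Finset.mem_of_mem_erase hy) z h1 h2 h3 h4 hyz⟩)
        obtain ⟨hl1, hl2⟩ := base (h.insert_vertex hG hrk hxnest hxgen)
        rw [← hdel] at hd1 hd2
        rw [← hlk, Finset.card_insert_of_notMem fun hxK => hxT (h.subset hxK)] at hl2
        rw [← hlk] at hl1
        refine VertexDecomposable.of_card (v := x) ?_ hd1 hd2 hl1 hl2
        refine ⟨Finset.disjoint_singleton_left.2 fun hxK => hxT (h.subset hxK), ?_, ?_⟩
        · rwa [← Finset.insert_eq]
        · intro s hs
          rw [Finset.mem_singleton.1 hs]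
          exact .inl (.inr hx.1)
    obtain ⟨X, hX⟩ : ∃ X : Finset L, ∀ x, x ∈ X ↔ x ∉ T ∧ IsNested G (insert x T) ∧
        gen T (insert e (A : Set L)) x = x ∧ gen T A x ≠ x :=
      ⟨(Set.toFinite {x | x ∉ T ∧ IsNested G (insert x T) ∧
        gen T (insert e (A : Set L)) x = x ∧ gen T A x ≠ x}).toFinset, fun x => by
          rw [Set.Finite.mem_toFinset]; rfl⟩
    have heq : relativeComplex G K T {s | gen T (insert e (A : Set L)) s = s} =
        relativeComplex G K T ({s | gen T A s = s} ∪ X) := by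
      ext S
      refine Iff.trans (mem_relativeComplex (S := S))
        (Iff.trans ?_ (mem_relativeComplex (S := S)).symm)
      refine and_congr_right fun _ => and_congr_right fun hnest => forall₂_congr fun s hs => ?_
      constructor
      · intro h1
        by_cases hsT : s ∈ T
        · exact .inr hsT
        by_cases hsA : gen T A s = s
        · exact .inl (.inl hsA)
        refine .inl (.inr (Finset.mem_coe.2 ((hX s).2 ⟨hsT, hnest.mono ?_,
          h1.resolve_right hsT, hsA⟩)))
        exact Finset.insert_subset (Finset.mem_union_left T hs) Finset.subset_union_right
      · rintro ((h1 | h1) | h1)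
        · exact .inl (le_antisymm (gen_le _ _ _) (Eq.ge h1 |>.trans
            (gen_mono le_rfl (Set.subset_insert e _) le_rfl)))
        · exact .inl ((hX s).1 (Finset.mem_coe.1 h1)).2.2.1
        · exact .inr h1
    rw [heq]
    exact step _ X rfl (fun x hx => (hX x).1 hx)
      (fun x _ y h1 h2 h3 h4 _ => (hX y).2 ⟨h1, h2, h3, h4⟩)

/-- The nested set complexes of a finite geometric lattice, given by its rank function, are
vertex decomposable. -/
theorem IsBuildingSet.vertexDecomposable_nestedSetComplex [IsAtomistic L] (hG : IsBuildingSet G)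
    (hrk : StrictMono rk) (hbot : rk ⊥ = 0)
    (hatom : ∀ x e, IsAtom e → rk (x ⊔ e) ≤ rk x + 1) :
    VertexDecomposable (nestedSetComplex G) := by
  classical
  obtain ⟨T, hT⟩ : ∃ T : Finset L, ∀ x, x ∈ T ↔ Maximal (· ∈ G) x :=
    ⟨(Set.toFinite {x | Maximal (· ∈ G) x}).toFinset, fun x => by simp⟩
  obtain ⟨A, hA⟩ : ∃ A : Finset L, ∀ x, x ∈ A ↔ IsAtom x :=
    ⟨(Set.toFinite {x : L | IsAtom x}).toFinset, fun x => by simp⟩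
  -- In an atomistic lattice all atoms together generate everything.
  have hgen : ∀ s, gen T A s = s := fun s => le_antisymm (gen_le _ _ _)
    (le_iff_atom_le_imp.2 fun a ha has => le_gen_right (Finset.mem_coe.2 ((hA a).2 ha)) has)
  have hunion : ∀ S : Finset L, IsNested G (S ∪ T) ↔ IsNested G S := by
    refine fun S => ⟨fun h => h.mono Finset.subset_union_left, fun h => ?_⟩
    rw [hG.isNested_iff] at h ⊢
    refine ⟨fun x hx => ?_, fun B hB hBG => ?_⟩
    · rcases Finset.mem_union.1 (Finset.mem_coe.1 hx) with hx | hx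
      · exact h.1 hx
      · exact ((hT x).1 hx).1
    · by_cases hBS : B ⊆ S
      · exact h.2 B hBS hBG
      obtain ⟨m, hmB, hmS⟩ := Set.not_subset.1 hBS
      have hm := (hT m).1 ((Finset.mem_union.1 (Finset.mem_coe.1 (hB hmB))).resolve_left hmS)
      have : sSup B = m := le_antisymm (hm.2 hBG (le_sSup hmB)) (le_sSup hmB)
      exact this ▸ hmB
  have hgood : IsGood G rk T T A := by
    refine ⟨subset_rfl, ?_, fun x hx => (hT x).2 hx, fun t _ => .inl (hgen t)⟩
    have := (hunion ∅).2 ⟨by simp, fun B hB hcard => by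
      rw [Finset.subset_empty.1 hB] at hcard
      simp at hcard⟩
    rwa [Finset.empty_union] at this
  have heq : nestedSetComplex G = relativeComplex G T T {s | gen T A s = s} := by
    ext S
    refine Iff.trans ?_ (mem_relativeComplex (S := S)).symm
    rw [hunion]
    constructor
    · rintro ⟨h1, h2⟩
      exact ⟨Finset.disjoint_left.2 fun x hx hxT => h2 x hx ((hT x).1 hxT), h1,
        fun s _ => .inl (hgen s)⟩
    · rintro ⟨h1, h2, -⟩
      exact ⟨h2, fun x hx hm => Finset.disjoint_left.1 h1 hx ((hT x).2 hm)⟩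
  rw [heq]
  exact (hgood.vertexDecomposable hG hrk hbot hatom A fun a ha => (hA a).1 ha).1

end Geometric

/-! ### The geometric lattice of flats -/

section Flats

variable {α : Type*} {M : Matroid α}

theorem flats_le_iff {F F' : Flats M} : F ≤ F' ↔ F.1 ⊆ F'.1 := Iff.rfl

/-- The flat spanned by one element. -/
def point (M : Matroid α) (x : α) : Flats M := ⟨M.closure {x}, M.isFlat_closure {x}⟩

theorem point_le_iff {x : α} (hx : x ∈ M.E) {F : Flats M} : point M x ≤ F ↔ x ∈ F.1 := by
  refine ⟨fun h => h (M.mem_closure_of_mem rfl (Set.singleton_subset_iff.2 hx)), fun h => ?_⟩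
  exact flats_le_iff.2 (F.2.closure ▸ M.closure_subset_closure (Set.singleton_subset_iff.2 h))

theorem flats_coe_bot : ((⊥ : Flats M) : Set α) = M.loops := by
  apply subset_antisymm
  · exact flats_le_iff.1 (bot_le : ⊥ ≤ (⟨M.closure ∅, M.isFlat_closure ∅⟩ : Flats M))
  · exact (⊥ : Flats M).2.loops_subset

/-- By exchange, a flat inside the point that contains a nonloop `y` contains `x` as well. -/
theorem isAtom_point {x : α} (hx : x ∈ M.E) (hx' : x ∉ M.loops) : IsAtom (point M x) := by
  refine ⟨fun h => hx' ?_, fun F hF => ?_⟩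
  · rw [← flats_coe_bot, ← point_le_iff hx, h]
  · by_contra hne
    obtain ⟨y, hyF, hy⟩ := Set.not_subset.1 (fun h => hne (le_bot_iff.1 (flats_le_iff.2 h)))
    rw [flats_coe_bot] at hy
    have hyx : y ∈ M.closure (insert x ∅) \ M.closure ∅ := by
      rw [insert_empty_eq]
      exact ⟨flats_le_iff.1 hF.le hyF, hy⟩
    have := (M.closure_exchange hyx).1
    rw [insert_empty_eq] at this
    refine hF.not_ge (flats_le_iff.2 ?_)
    have hxF : x ∈ F.1 := F.2.closure ▸
      M.closure_subset_closure (Set.singleton_subset_iff.2 hyF) this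
    exact flats_le_iff.1 ((point_le_iff hx).2 hxF)

theorem exists_eq_point {F : Flats M} (hF : IsAtom F) : ∃ x ∈ M.E, F = point M x := by
  obtain ⟨x, hxF, hx⟩ := Set.not_subset.1 (fun h => hF.1 (le_bot_iff.1 (flats_le_iff.2 h)))
  rw [flats_coe_bot] at hx
  have hxE := F.2.subset_ground hxF
  exact ⟨x, hxE, ((hF.le_iff.1 ((point_le_iff hxE).2 hxF)).resolve_left
    (isAtom_point hxE hx).1).symm⟩

instance : IsAtomistic (Flats M) := by
  refine CompleteLattice.isAtomistic_iff.2 fun F => ⟨{a | IsAtom a ∧ a ≤ F}, ?_, fun a ha => ha.1⟩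
  refine le_antisymm (flats_le_iff.2 fun x hx => ?_) (sSup_le fun a ha => ha.2)
  by_cases hl : x ∈ M.loops
  · exact (sSup {a : Flats M | IsAtom a ∧ a ≤ F}).2.loops_subset hl
  · have hxE := F.2.subset_ground hx
    exact (point_le_iff hxE).1 (le_sSup ⟨isAtom_point hxE hl, (point_le_iff hxE).2 hx⟩)

instance [M.Finite] : Finite (Flats M) :=
  (M.ground_finite.finite_subsets.subset fun _ h => Matroid.IsFlat.subset_ground h).to_subtype

/-- The rank of a flat. -/
noncomputable def flatRank (F : Flats M) : ℕ := (M.eRk F.1).toNat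

theorem coe_flatRank [M.Finite] (F : Flats M) : (flatRank F : ℕ∞) = M.eRk F.1 :=
  ENat.natCast_toNat (Matroid.eRk_ne_top_iff.2 (M.isRkFinite_set F.1))

theorem flatRank_bot [M.Finite] : flatRank (⊥ : Flats M) = 0 := by
  simp [flatRank, flats_coe_bot, Matroid.loops]

theorem flatRank_strictMono [M.Finite] : StrictMono (flatRank (M := M)) := by
  intro F F' h
  by_contra hle
  have hle' : M.eRk F'.1 ≤ M.eRk F.1 := by
    rw [← coe_flatRank, ← coe_flatRank]
    exact_mod_cast not_lt.1 hle
  have := (M.isRkFinite_set F.1).closure_eq_closure_of_subset_of_eRk_ge_eRk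
    (flats_le_iff.1 h.le) hle'
  rw [F.2.closure, F'.2.closure] at this
  exact h.ne (Subtype.ext this)

theorem flatRank_sup_le [M.Finite] (F e : Flats M) (he : IsAtom e) :
    flatRank (F ⊔ e) ≤ flatRank F + 1 := by
  obtain ⟨x, hx, rfl⟩ := exists_eq_point he
  have hsub : insert x F.1 ⊆ M.E := Set.insert_subset hx F.2.subset_ground
  have hle : F ⊔ point M x ≤ ⟨M.closure (insert x F.1), M.isFlat_closure _⟩ :=
    sup_le (flats_le_iff.2 ((Set.subset_insert x F.1).trans (M.subset_closure _ hsub)))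
      ((point_le_iff hx).2 (M.subset_closure _ hsub (Set.mem_insert x _)))
  have h1 := (M.eRk_mono (flats_le_iff.1 hle)).trans
    ((M.eRk_closure_eq _).le.trans (M.eRk_insert_le_add_one x F.1))
  rw [← coe_flatRank, ← coe_flatRank] at h1
  exact_mod_cast h1

end Flats

end NestedSets

theorem mainTheorem4 {α : Type*} (M : Matroid α) [M.Finite]
    (G : Set (NestedSets.Flats M)) (hG : NestedSets.IsBuildingSet G) :
    NestedSets.VertexDecomposable (NestedSets.nestedSetComplex G) ∧
      NestedSets.Shellable (NestedSets.nestedSetComplex G) := by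
  have h := hG.vertexDecomposable_nestedSetComplex NestedSets.flatRank_strictMono
    NestedSets.flatRank_bot NestedSets.flatRank_sup_le
  exact ⟨h, h.shellable⟩
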